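/- Let $n\in\mathbb N$, $\mathcal C=[-1,1]^n\subset\mathbb R^n$ and $I=[0,1]$. Let $S\subset\mathcal C$ be Borel measurable and countably $1$-rectifiable (a countable union of Lipschitz images of bounded subsets of $\mathbb R$), let $a\in[0,\infty]$, and let $b:S\to[0,a]$ be lower semi-continuous. Assume that $\mathcal H^1(\{z\in S: b(z)\le\lambda\})<\infty$ for all $\lambda\in[0,a)$, where $\mathcal H^1$ is the one-dimensional Hausdorff measure. Extend $b$ to $\mathcal C\setminus S$ by the value $a$, and use the convention $0\cdot\infty=0$. For $x,y\in\mathcal C$ let $\Gamma^{xy}$ be the set of Lipschitz paths $\gamma:I\to\mathcal C$ with $\gamma(0)=x$ and $\gamma(1)=y$, and let $\Gamma^{xy}_C$ be the set of those with Lipschitz constant at most $C$ (with respect to the Euclidean norm). Define the generalized urban metric $$d(x,y)=\inf_{\gamma\in\Gamma^{xy}}\left(\int_{\gamma(I)\cap S}b\,\mathrm d\mathcal H^1+a\,\mathcal H^1(\gamma(I)\setminus S)\right)\in[0,\infty]$$ and the path length $$L(\gamma)=\int_0^1 b(\gamma(t))\,|\dot\gamma(t)|\,\mathrm dt\in[0,\infty].$$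 **Proposition (Optimal path limit).** Let $((x_j,y_j))_{j\in\mathbb N}\subset\mathcal C\times\mathcal C$ be a sequence such that $d(x_j,y_j)$ is uniformly bounded, i.e. $\sup_j d(x_j,y_j)<\infty$. Let $C\ge 0$ and let $\gamma_j\in\Gamma_C^{x_jy_j}$ satisfy $L(\gamma_j)=d(x_j,y_j)$, where each $\gamma_j$ has constant speed, i.e. $|\dot\gamma_j|$ is almost everywhere equal to a constant (which may depend on $j$). Suppose that $\gamma_j\to\gamma$ uniformly on $I$ for some $\gamma\in\Gamma_C^{xy}$. Then $\gamma$ is optimal: $L(\gamma)=d(x,y)$. -/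

import Mathlib

open Set Filter Topology MeasureTheory
open scoped NNReal ENNReal

noncomputable section

namespace UrbanMetric

/-- The hypercube `[-1,1]^n` in Euclidean `n`-space. -/
def cube (n : ℕ) : Set (EuclideanSpace ℝ (Fin n)) :=
  {z | ∀ i, z i ∈ Icc (-1 : ℝ) 1}

/-- A set is countably `1`-rectifiable if it is a countable union of Lipschitz images of bounded
subsets of the real line. -/
def CountablyRectifiable {n : ℕ} (S : Set (EuclideanSpace ℝ (Fin n))) : Prop :=
  ∃ (A : ℕ → Set ℝ) (f : ℕ → ℝ → EuclideanSpace ℝ (Fin n)),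
    (∀ i, Bornology.IsBounded (A i) ∧ ∃ K : ℝ≥0, LipschitzOnWith K (f i) (A i)) ∧
      S = ⋃ i, f i '' A i

/-- The part of the network with friction coefficient at most `lam`. -/
def sublevel {n : ℕ} (S : Set (EuclideanSpace ℝ (Fin n)))
    (b : EuclideanSpace ℝ (Fin n) → ℝ≥0∞) (lam : ℝ≥0∞) : Set (EuclideanSpace ℝ (Fin n)) :=
  {z ∈ S | b z ≤ lam}

/-- A street network `S` in the cube, with lower semicontinuous friction coefficient
`b : S → [0,a]` and cost `a ∈ [0,∞]` off the network, such that for every `lam ∈ [0,a)` the part of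
the network with friction at most `lam` has finite length. Only the values of `b` on `S` matter. -/
structure IsNetwork {n : ℕ} (S : Set (EuclideanSpace ℝ (Fin n))) (a : ℝ≥0∞)
    (b : EuclideanSpace ℝ (Fin n) → ℝ≥0∞) : Prop where
  subset_cube : S ⊆ cube n
  rectifiable : CountablyRectifiable S
  measurableSet : MeasurableSet S
  lowerSemicontinuousOn : LowerSemicontinuousOn b S
  le_cost : ∀ z ∈ S, b z ≤ a
  finite_sublevel : ∀ lam < a, Measure.hausdorffMeasure 1 (sublevel S b lam) < ∞

open Classical in
/-- The friction coefficient extended by the value `a` off the network. -/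
def friction {n : ℕ} (S : Set (EuclideanSpace ℝ (Fin n))) (a : ℝ≥0∞)
    (b : EuclideanSpace ℝ (Fin n) → ℝ≥0∞) (z : EuclideanSpace ℝ (Fin n)) : ℝ≥0∞ :=
  if z ∈ S then b z else a

/-- `γ` restricted to `[0,1]` is a path in the cube from `x` to `y` with Lipschitz constant at most
`K`. Values of `γ` outside `[0,1]` play no role here or below. -/
structure IsPath {n : ℕ} (K : ℝ≥0) (x y : EuclideanSpace ℝ (Fin n))
    (γ : ℝ → EuclideanSpace ℝ (Fin n)) : Prop where
  lipschitz : LipschitzOnWith K γ (Icc 0 1)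
  mapsTo : MapsTo γ (Icc 0 1) (cube n)
  source : γ 0 = x
  target : γ 1 = y

/-- The path has constant speed: `|γ'|` is almost everywhere equal to one constant. -/
def ConstantSpeed {n : ℕ} (γ : ℝ → EuclideanSpace ℝ (Fin n)) : Prop :=
  ∃ v : ℝ, ∀ᵐ t ∂(volume.restrict (Icc (0 : ℝ) 1)), ‖derivWithin γ (Icc 0 1) t‖ = v

/-- The path length `∫ b(γ) |γ'| dt` over `[0,1]`, which counts multiplicity. -/
def length {n : ℕ} (S : Set (EuclideanSpace ℝ (Fin n))) (a : ℝ≥0∞)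
    (b : EuclideanSpace ℝ (Fin n) → ℝ≥0∞) (γ : ℝ → EuclideanSpace ℝ (Fin n)) : ℝ≥0∞ :=
  ∫⁻ t in Icc (0 : ℝ) 1, friction S a b (γ t) * ‖derivWithin γ (Icc 0 1) t‖ₑ

/-- The travel cost of a path, which only depends on its image. -/
def imageCost {n : ℕ} (S : Set (EuclideanSpace ℝ (Fin n))) (a : ℝ≥0∞)
    (b : EuclideanSpace ℝ (Fin n) → ℝ≥0∞) (γ : ℝ → EuclideanSpace ℝ (Fin n)) : ℝ≥0∞ :=
  (∫⁻ z in γ '' Icc 0 1 ∩ S, b z ∂(Measure.hausdorffMeasure 1)) +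
    a * Measure.hausdorffMeasure 1 (γ '' Icc 0 1 \ S)

/-- The generalized urban metric: the infimum of the travel costs of all Lipschitz paths in the
cube from `x` to `y`. -/
def urbanDist {n : ℕ} (S : Set (EuclideanSpace ℝ (Fin n))) (a : ℝ≥0∞)
    (b : EuclideanSpace ℝ (Fin n) → ℝ≥0∞) (x y : EuclideanSpace ℝ (Fin n)) : ℝ≥0∞ :=
  ⨅ (γ : ℝ → EuclideanSpace ℝ (Fin n)) (_ : ∃ K : ℝ≥0, IsPath K x y γ), imageCost S a b γ

end UrbanMetric

end

/-! Write F for the friction and L for the length. L(γ) ≥ d(x,y) holds because the area inequality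
without injectivity bounds integrals over an image by curve integrals
(`LipschitzWith.setLIntegral_image_le`).

For L(γ) ≤ d(x,y), L is first shown to be lower semicontinuous
(`lintegral_mul_enorm_deriv_le_liminf`). By layer cake, L integrates over r the length spent outside
{F ≤ r}, a set of finite 𝓗¹ measure when r < a. Length outside such a set A is lower semicontinuous:
inside A, the image of γ_j has measure at most that of A near the image of γ, which tends to the
measure of A on that image.

This alone is not enough: for a = ∞, Euclidean convergence of endpoints does not give d(x_j,x) → 0.
So cheap end arcs of γ are cut off, at times s and t with γ(s) ≠ x and γ(t) ≠ y. On [0,s] and [t,1]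
the curve γ_j has points d-close to x and y (`eventually_exists_urbanDist_le`): for a < ∞ since d ≤
a|·|, for a = ∞ since γ_j must meet γ there, as avoiding it would force long travel at arbitrarily
high friction. Arcs of γ_j being optimal, its cost on [s,t] is at most d(x,y) plus a small error,
which passes to γ by semicontinuity. -/

noncomputable section

/-! ### Length and area inequalities for curves -/

section Curves

/-- The image of a curve has at least the length of the distance of its endpoints. -/
theorem edist_le_hausdorffMeasure_image {X : Type*} [MetricSpace X]
    [MeasurableSpace X] [BorelSpace X] {γ : ℝ → X} {s t : ℝ}
    (hst : s ≤ t) (hγ : ContinuousOn γ (Icc s t)) :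
    edist (γ s) (γ t) ≤ Measure.hausdorffMeasure 1 (γ '' Icc s t) := by
  -- Distance to `γ s` is 1-Lipschitz, so it does not increase 𝓗¹, and by the intermediate value
  -- theorem it maps the curve onto an interval of the required length or more.
  have hl : LipschitzWith 1 fun z ↦ dist z (γ s) := LipschitzWith.dist_left _
  have h1 := hl.hausdorffMeasure_image_le (d := 1) zero_le_one (γ '' Icc s t)
  rw [hausdorffMeasure_real] at h1
  have h2 : Icc 0 (dist (γ t) (γ s)) ⊆ (fun z ↦ dist z (γ s)) '' (γ '' Icc s t) := by
    rw [image_image]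
    have := intermediate_value_Icc hst (hl.continuous.comp_continuousOn hγ)
    simpa using this
  calc edist (γ s) (γ t) = volume (Icc 0 (dist (γ t) (γ s))) := by
        rw [Real.volume_Icc, sub_zero, edist_comm, edist_dist]
    _ ≤ _ := (measure_mono h2).trans (by simpa using h1)

variable {E : Type*} [NormedAddCommGroup E] [NormedSpace ℝ E]

/-- The speed of a curve is dominated by the derivative of any function dominating its
increments. -/
theorem norm_deriv_le_of_dist_le {γ : ℝ → E} {v : ℝ → ℝ} {x : ℝ}
    (hv : DifferentiableAt ℝ v x) (h : ∀ y, dist (γ x) (γ y) ≤ |v y - v x|) :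
    ‖deriv γ x‖ ≤ ‖deriv v x‖ := by
  by_cases hγ : DifferentiableAt ℝ γ x
  · have h1 := (hasDerivAt_iff_tendsto_slope.1 hγ.hasDerivAt).norm
    have h2 := (hasDerivAt_iff_tendsto_slope.1 hv.hasDerivAt).norm
    refine le_of_tendsto_of_tendsto' h1 h2 fun y ↦ ?_
    simp only [slope_def_module, norm_smul, Real.norm_eq_abs]
    gcongr
    rw [← dist_eq_norm, dist_comm]
    exact h y
  · rw [deriv_zero_of_not_differentiableAt hγ, norm_zero]
    exact norm_nonneg _

/-- The integral of the speed of a curve is at most its variation. -/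
theorem LocallyBoundedVariationOn.lintegral_enorm_deriv_le {γ : ℝ → E}
    (hγ : LocallyBoundedVariationOn γ univ) {s t : ℝ} (hst : s ≤ t) :
    ∫⁻ r in Icc s t, ‖deriv γ r‖ₑ ≤ eVariationOn γ (Icc s t) := by
  set v : ℝ → ℝ := fun r ↦ variationOnFromTo γ univ s r with hv
  have hmono : Monotone v :=
    monotoneOn_univ.1 (variationOnFromTo.monotoneOn hγ (mem_univ s))
  have hdist_of_le : ∀ x y, x ≤ y → dist (γ x) (γ y) ≤ v y - v x := by
    intro x y hxy
    have hadd := variationOnFromTo.add hγ (mem_univ s) (mem_univ x) (mem_univ y)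
    have h1 : v y - v x = variationOnFromTo γ univ x y := by
      simp only [hv]; linarith
    rw [h1, variationOnFromTo.eq_of_le _ _ hxy, dist_edist]
    refine ENNReal.toReal_mono (hγ x y trivial trivial) (eVariationOn.edist_le _ ?_ ?_)
    · exact ⟨trivial, le_rfl, hxy⟩
    · exact ⟨trivial, hxy, le_rfl⟩
  have hdist : ∀ x y, dist (γ x) (γ y) ≤ |v y - v x| := by
    intro x y
    rcases le_total x y with hxy | hxy
    · exact (hdist_of_le x y hxy).trans (le_abs_self _)
    · rw [dist_comm, abs_sub_comm]
      exact (hdist_of_le y x hxy).trans (le_abs_self _)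
  -- Fatou along `G` gives ∫ v' ≤ v(t) - v(s) for monotone `v`; any singular part of `v` is only
  -- lost.
  obtain ⟨G, hG, hGm, hGl⟩ :=
    (hmono.monotoneOn (Icc s t)).exists_tendsto_deriv_liminf_lintegral_enorm_le hst
  calc ∫⁻ r in Icc s t, ‖deriv γ r‖ₑ
      ≤ ∫⁻ r in Icc s t, ‖deriv v r‖ₑ := by
        refine lintegral_mono_ae (ae_restrict_of_ae ?_)
        filter_upwards [hmono.ae_differentiableAt] with x hx
        exact enorm_le_iff_norm_le.2 (norm_deriv_le_of_dist_le hx (hdist x))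
    _ ≤ liminf (fun n ↦ ∫⁻ x in Icc s t, ‖G n x‖ₑ) atTop := by
        refine le_trans (lintegral_mono_ae ?_)
          (lintegral_liminf_le' fun n ↦ (hGm n).aemeasurable.enorm)
        filter_upwards [hG] with x hx
        exact hx.enorm.liminf_eq.ge
    _ ≤ ENNReal.ofReal (v t - v s) := hGl
    _ = eVariationOn γ (Icc s t) := by
        simp only [hv, variationOnFromTo.self, sub_zero, variationOnFromTo.eq_of_le _ _ hst]
        rw [ENNReal.ofReal_toReal (hγ s t trivial trivial), univ_inter]

variable [FiniteDimensional ℝ E] [MeasurableSpace E] [BorelSpace E]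

/-- Where the speed of a curve is at most `c`, the curve increases length at most by `c`. -/
theorem hausdorffMeasure_image_le_mul_of_norm_deriv_le {γ : ℝ → E} {s : Set ℝ}
    (hs : MeasurableSet s) (hvol : volume s ≠ ∞) (hd : ∀ x ∈ s, DifferentiableAt ℝ γ x) {c : ℝ≥0}
    (hc : ∀ x ∈ s, ‖deriv γ x‖ ≤ c) :
    Measure.hausdorffMeasure 1 (γ '' s) ≤ c * volume s := by
  rcases s.eq_empty_or_nonempty with rfl | hne
  · simp
  have key : ∀ ε : ℝ≥0, ε ≠ 0 →
      Measure.hausdorffMeasure 1 (γ '' s) ≤ ((c + ε : ℝ≥0) : ℝ≥0∞) * volume s := by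
    intro ε hε
    -- On each piece `γ` is `ε`-close to a linear map that is a derivative of `γ` somewhere in `s`,
    -- hence is Lipschitz with constant `c + ε`.
    obtain ⟨t, A, htd, htm, hst, happ, hA⟩ :=
      exists_partition_approximatesLinearOn_of_hasFDerivWithinAt γ s (fun x ↦ fderiv ℝ γ x)
        (fun x hx ↦ (hd x hx).hasFDerivAt.hasFDerivWithinAt) (fun _ ↦ ε) (fun _ ↦ hε)
    have hAc : ∀ n, ‖A n‖₊ ≤ c := by
      intro n
      obtain ⟨y, hy, hAy⟩ := hA hne n
      rw [hAy, ← NNReal.coe_le_coe, coe_nnnorm, ← norm_deriv_eq_norm_fderiv]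
      exact hc y hy
    have hpiece : ∀ n, Measure.hausdorffMeasure 1 (γ '' (s ∩ t n)) ≤
        ((c + ε : ℝ≥0) : ℝ≥0∞) * volume (s ∩ t n) := by
      intro n
      have hl : LipschitzOnWith (c + ε) γ (s ∩ t n) :=
        (lipschitzOnWith_iff_restrict.2 (happ n).lipschitz).weaken
          (add_le_add_left (hAc n) ε)
      have := hl.hausdorffMeasure_image_le (d := 1) zero_le_one
      rwa [ENNReal.rpow_one, hausdorffMeasure_real] at this
    have hun : s = ⋃ n, s ∩ t n := by
      rw [← inter_iUnion, inter_eq_left.2 hst]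
    calc Measure.hausdorffMeasure 1 (γ '' s)
        = Measure.hausdorffMeasure 1 (⋃ n, γ '' (s ∩ t n)) := by
          rw [← image_iUnion, ← hun]
      _ ≤ ∑' n, Measure.hausdorffMeasure 1 (γ '' (s ∩ t n)) := measure_iUnion_le _
      _ ≤ ∑' n, ((c + ε : ℝ≥0) : ℝ≥0∞) * volume (s ∩ t n) := ENNReal.tsum_le_tsum hpiece
      _ = ((c + ε : ℝ≥0) : ℝ≥0∞) * volume s := by
          rw [ENNReal.tsum_mul_left, ← measure_iUnion _ fun n ↦ hs.inter (htm n), ← hun]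
          exact fun i j hij ↦ (htd hij).mono inter_subset_right inter_subset_right
  refine ge_of_tendsto (f := fun ε : ℝ≥0 ↦ ((c + ε : ℝ≥0) : ℝ≥0∞) * volume s)
    (x := 𝓝[≠] 0) ?_ (eventually_nhdsWithin_of_forall key)
  have : Tendsto (fun ε : ℝ≥0 ↦ ((c + ε : ℝ≥0) : ℝ≥0∞)) (𝓝[≠] 0) (𝓝 ((c + 0 : ℝ≥0) : ℝ≥0∞)) :=
    (ENNReal.tendsto_coe.2 (tendsto_const_nhds.add tendsto_id)).mono_left nhdsWithin_le_nhds
  simpa using ENNReal.Tendsto.mul_const this (Or.inr hvol)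

/-- The length of the image of a Lipschitz curve is at most the integral of its speed. -/
theorem LipschitzWith.hausdorffMeasure_image_le_lintegral {γ : ℝ → E} {K : ℝ≥0}
    (hγ : LipschitzWith K γ) {s : Set ℝ} (hs : MeasurableSet s) (hvol : volume s ≠ ∞) :
    Measure.hausdorffMeasure 1 (γ '' s) ≤ ∫⁻ r in s, ‖deriv γ r‖ₑ := by
  set D : Set ℝ := {x | DifferentiableAt ℝ γ x} with hD
  have hDm : MeasurableSet D := measurableSet_of_differentiableAt ℝ γ
  have hDc : volume (s \ D) = 0 :=
    measure_mono_null (fun x hx ↦ hx.2) (ae_iff.1 hγ.ae_differentiableAt)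
  have hnull : Measure.hausdorffMeasure 1 (γ '' (s \ D)) = 0 := by
    have := hγ.hausdorffMeasure_image_le (d := 1) zero_le_one (s \ D)
    rw [hausdorffMeasure_real, hDc, mul_zero] at this
    exact nonpos_iff_eq_zero.1 this
  have key : ∀ ε : ℝ≥0, 0 < ε → Measure.hausdorffMeasure 1 (γ '' s) ≤
      (∫⁻ r in s, ‖deriv γ r‖ₑ) + ε * volume s := by
    intro ε hε
    -- On `P k` the speed lies in [kε, (k+1)ε), so the bound (k+1)ε overshoots it by at most ε.
    set P : ℕ → Set ℝ := fun k ↦ s ∩ D ∩ {x | ⌊‖deriv γ x‖₊ / ε⌋₊ = k} with hP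
    have hPm : ∀ k, MeasurableSet (P k) := fun k ↦ (hs.inter hDm).inter <|
      (Nat.measurable_floor.comp ((measurable_deriv γ).nnnorm.div_const ε))
        (measurableSet_singleton k)
    have hPd : Pairwise (Function.onFun Disjoint P) := fun i j hij ↦
      Set.disjoint_left.2 fun x hx hx' ↦ hij (hx.2.symm.trans hx'.2)
    have hPu : s ∩ D = ⋃ k, P k := by
      ext x
      simp [hP]
    have hpiece : ∀ k, Measure.hausdorffMeasure 1 (γ '' P k) ≤
        ∫⁻ r in P k, (‖deriv γ r‖ₑ + ε) := by
      intro k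
      have h1 := hausdorffMeasure_image_le_mul_of_norm_deriv_le (γ := γ) (hPm k)
        (measure_ne_top_of_subset (inter_subset_left.trans inter_subset_left) hvol)
        (fun x hx ↦ hx.1.2) (c := (k + 1) * ε) (by
          intro x hx
          have h2 := (Nat.lt_floor_add_one (‖deriv γ x‖₊ / ε)).le
          rw [hx.2, div_le_iff₀ hε] at h2
          exact_mod_cast h2)
      refine h1.trans ?_
      rw [← setLIntegral_const]
      refine setLIntegral_mono ((measurable_deriv γ).enorm.add_const _) fun x hx ↦ ?_
      have h2 := Nat.floor_le (a := ‖deriv γ x‖₊ / ε) (by positivity)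
      rw [hx.2, le_div_iff₀ hε] at h2
      rw [enorm_eq_nnnorm]
      norm_cast
      push_cast
      rw [add_mul, one_mul]
      gcongr
    calc Measure.hausdorffMeasure 1 (γ '' s)
        ≤ Measure.hausdorffMeasure 1 (γ '' (s ∩ D)) +
            Measure.hausdorffMeasure 1 (γ '' (s \ D)) := by
          rw [← inter_union_sdiff s D, image_union, inter_union_sdiff]
          exact measure_union_le _ _
      _ = Measure.hausdorffMeasure 1 (⋃ k, γ '' P k) := by
          rw [hnull, add_zero, hPu, image_iUnion]
      _ ≤ ∑' k, Measure.hausdorffMeasure 1 (γ '' P k) := measure_iUnion_le _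
      _ ≤ ∑' k, ∫⁻ r in P k, (‖deriv γ r‖ₑ + ε) := ENNReal.tsum_le_tsum hpiece
      _ = ∫⁻ r in s ∩ D, (‖deriv γ r‖ₑ + ε) := by rw [hPu, lintegral_iUnion hPm hPd]
      _ ≤ ∫⁻ r in s, (‖deriv γ r‖ₑ + ε) := lintegral_mono_set inter_subset_left
      _ = (∫⁻ r in s, ‖deriv γ r‖ₑ) + ε * volume s := by
          rw [lintegral_add_right _ measurable_const, setLIntegral_const]
  refine ge_of_tendsto (f := fun ε : ℝ≥0 ↦ (∫⁻ r in s, ‖deriv γ r‖ₑ) + ε * volume s)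
    (x := 𝓝[>] 0) ?_ (eventually_nhdsWithin_of_forall key)
  have h1 : Tendsto (fun ε : ℝ≥0 ↦ (ε : ℝ≥0∞)) (𝓝[>] 0) (𝓝 ((0 : ℝ≥0) : ℝ≥0∞)) :=
    (ENNReal.tendsto_coe.2 tendsto_id).mono_left nhdsWithin_le_nhds
  simpa using tendsto_const_nhds.add (ENNReal.Tendsto.mul_const h1 (Or.inr hvol))

/-- Integrals over the image of a Lipschitz curve are at most the corresponding curve integrals. -/
theorem LipschitzWith.setLIntegral_image_le {γ : ℝ → E} {K : ℝ≥0}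
    (hγ : LipschitzWith K γ) {s : Set ℝ} (hs : MeasurableSet s) (hvol : volume s ≠ ∞)
    {f : E → ℝ≥0∞} (hf : Measurable f) :
    ∫⁻ z in γ '' s, f z ∂(Measure.hausdorffMeasure 1) ≤ ∫⁻ r in s, f (γ r) * ‖deriv γ r‖ₑ := by
  have hγm : Measurable γ := hγ.continuous.measurable
  have hsp : Measurable fun r ↦ ‖deriv γ r‖ₑ := (measurable_deriv γ).enorm
  -- Tested on Borel sets this is the previous length bound; multiple coverings make it an
  -- inequality only.
  have hle : (Measure.hausdorffMeasure 1).restrict (γ '' s) ≤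
      ((volume.restrict s).withDensity fun r ↦ ‖deriv γ r‖ₑ).map γ := by
    refine Measure.le_iff.2 fun A hA ↦ ?_
    rw [Measure.restrict_apply hA, Measure.map_apply hγm hA, withDensity_apply _ (hγm hA),
      Measure.restrict_restrict (hγm hA), inter_comm, ← image_inter_preimage, inter_comm]
    exact hγ.hausdorffMeasure_image_le_lintegral ((hγm hA).inter hs)
      (measure_ne_top_of_subset inter_subset_right hvol)
  calc ∫⁻ z in γ '' s, f z ∂(Measure.hausdorffMeasure 1)
      ≤ ∫⁻ z, f z ∂((volume.restrict s).withDensity fun r ↦ ‖deriv γ r‖ₑ).map γ :=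
        lintegral_mono' hle le_rfl
    _ = ∫⁻ r in s, f (γ r) * ‖deriv γ r‖ₑ := by
        rw [lintegral_map hf hγm, lintegral_withDensity_eq_lintegral_mul _ hsp (by fun_prop)]
        simp [mul_comm]

end Curves

/-! ### Tools for extended nonnegative numbers -/

/-- Superadditivity of the limit inferior of extended nonnegative numbers. -/
theorem ENNReal.liminf_add_liminf_le (u v : ℕ → ℝ≥0∞) :
    liminf u atTop + liminf v atTop ≤ liminf (fun j ↦ u j + v j) atTop := by
  simp only [liminf_eq_iSup_iInf_of_nat]
  rw [ENNReal.iSup_add_iSup_of_monotone]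
  · exact iSup_mono fun n ↦ le_iInf₂ fun i hi ↦
      add_le_add (iInf₂_le (f := fun i _ ↦ u i) i hi) (iInf₂_le (f := fun i _ ↦ v i) i hi)
  · exact fun m n hmn ↦ biInf_mono fun i hi ↦ hmn.trans hi
  · exact fun m n hmn ↦ biInf_mono fun i hi ↦ hmn.trans hi

/-- The layer cake formula for a single extended nonnegative number. -/
theorem ENNReal.lintegral_Ioi_indicator_lt (c : ℝ≥0∞) :
    ∫⁻ r in Ioi (0 : ℝ), {r : ℝ | ENNReal.ofReal r < c}.indicator 1 r = c := by
  rw [lintegral_indicator_one (measurableSet_lt ENNReal.measurable_ofReal measurable_const),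
    Measure.restrict_apply (measurableSet_lt ENNReal.measurable_ofReal measurable_const)]
  rcases eq_or_ne c ∞ with rfl | hc
  · simp
  · have : {r : ℝ | ENNReal.ofReal r < c} ∩ Ioi 0 = Ioo 0 c.toReal := by
      ext r
      simp only [mem_inter_iff, mem_ofPred_eq, mem_Ioi, mem_Ioo]
      exact ⟨fun h ↦ ⟨h.2, (ENNReal.ofReal_lt_iff_lt_toReal h.2.le hc).1 h.1⟩,
        fun h ↦ ⟨(ENNReal.ofReal_lt_iff_lt_toReal h.1.le hc).2 h.2, h.1⟩⟩
    rw [this, Real.volume_Ioo, sub_zero, ENNReal.ofReal_toReal hc]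

/-! ### Lower semicontinuity of weighted length -/

section Semicontinuity

variable {E : Type*} [NormedAddCommGroup E] [NormedSpace ℝ E] [FiniteDimensional ℝ E]
  [MeasurableSpace E] [BorelSpace E]

/-- The length of the part of a curve inside a set is at most the corresponding integral of the
speed. -/
theorem LipschitzWith.hausdorffMeasure_image_Icc_inter_le {γ : ℝ → E} {K : ℝ≥0}
    (hγ : LipschitzWith K γ) {A : Set E} (hA : MeasurableSet A) (s t : ℝ) :
    Measure.hausdorffMeasure 1 (γ '' Icc s t ∩ A) ≤
      ∫⁻ r in Ioc s t ∩ γ ⁻¹' A, ‖deriv γ r‖ₑ := by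
  rw [setLIntegral_congr (s := Ioc s t ∩ γ ⁻¹' A)
    (ae_eq_set_inter Ioc_ae_eq_Icc (ae_eq_refl (γ ⁻¹' A))), ← image_inter_preimage]
  exact hγ.hausdorffMeasure_image_le_lintegral
    (measurableSet_Icc.inter (hγ.continuous.measurable hA))
    (measure_ne_top_of_subset inter_subset_left isCompact_Icc.measure_lt_top.ne)

/-- The distance of the endpoints of a limit curve is bounded by the length that the converging
curves have outside a set `A` of finite length and that the limit curve has inside `A`. -/
theorem edist_le_liminf_lintegral_add {A : Set E} (hA : MeasurableSet A)
    (hAfin : Measure.hausdorffMeasure 1 A ≠ ∞) {γs : ℕ → ℝ → E} {γ : ℝ → E} {C K : ℝ≥0}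
    (hγs : ∀ j, LipschitzWith C (γs j)) (hγ : LipschitzWith K γ) {s t : ℝ} (hst : s ≤ t)
    (hlim : TendstoUniformlyOn γs γ atTop (Icc s t)) :
    edist (γ s) (γ t) ≤
      liminf (fun j ↦ ∫⁻ r in Ioc s t ∩ γs j ⁻¹' Aᶜ, ‖deriv (γs j) r‖ₑ) atTop +
        ∫⁻ r in Ioc s t ∩ γ ⁻¹' A, ‖deriv γ r‖ₑ := by
  -- Finiteness of `μ` gives continuity from above along the shrinking neighbourhoods of `S` and
  -- makes the truncated subtractions continuous.
  set μ : Measure E := (Measure.hausdorffMeasure 1).restrict A with hμ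
  have hfin : IsFiniteMeasure μ := ⟨by rw [hμ, Measure.restrict_apply_univ]; exact hAfin.lt_top⟩
  set S : Set E := γ '' Icc s t with hS
  have hSc : IsCompact S := isCompact_Icc.image hγ.continuous
  have hμS : μ S ≤ ∫⁻ r in Ioc s t ∩ γ ⁻¹' A, ‖deriv γ r‖ₑ := by
    rw [hμ, Measure.restrict_apply hSc.measurableSet]
    exact hγ.hausdorffMeasure_image_Icc_inter_le hA s t
  have hδ : ∀ δ : ℝ, 0 < δ → edist (γ s) (γ t) - μ (Metric.cthickening δ S) ≤
      liminf (fun j ↦ ∫⁻ r in Ioc s t ∩ γs j ⁻¹' Aᶜ, ‖deriv (γs j) r‖ₑ) atTop := by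
    intro δ hδ
    have hs := hlim.tendsto_at (left_mem_Icc.2 hst)
    have ht := hlim.tendsto_at (right_mem_Icc.2 hst)
    have h1 := ENNReal.Tendsto.sub (hs.edist ht)
      (tendsto_const_nhds (x := μ (Metric.cthickening δ S))) (Or.inr (measure_ne_top _ _))
    rw [← h1.liminf_eq]
    refine liminf_le_liminf ?_
    filter_upwards [Metric.tendstoUniformlyOn_iff.1 hlim δ hδ] with j hj
    rw [tsub_le_iff_right]
    have hsub : γs j '' Icc s t ⊆ Metric.cthickening δ S := by
      rintro _ ⟨r, hr, rfl⟩
      refine Metric.mem_cthickening_of_dist_le _ (γ r) _ _ (mem_image_of_mem _ hr) ?_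
      rw [dist_comm]
      exact (hj r hr).le
    have hcont := (hγs j).continuous
    calc edist (γs j s) (γs j t) ≤ Measure.hausdorffMeasure 1 (γs j '' Icc s t) :=
          edist_le_hausdorffMeasure_image hst hcont.continuousOn
      _ ≤ Measure.hausdorffMeasure 1 (γs j '' Icc s t ∩ Aᶜ) +
            Measure.hausdorffMeasure 1 (γs j '' Icc s t ∩ A) := by
          rw [add_comm, ← sdiff_eq]
          exact measure_le_inter_add_sdiff _ _ _
      _ ≤ _ := by
          refine add_le_add ((hγs j).hausdorffMeasure_image_Icc_inter_le hA.compl s t) ?_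
          rw [hμ, Measure.restrict_apply Metric.isClosed_cthickening.measurableSet]
          exact measure_mono (inter_subset_inter_left _ hsub)
  refine le_trans ?_ (add_le_add_right hμS _)
  rw [← tsub_le_iff_right]
  have h2 : Tendsto (fun δ ↦ μ (Metric.cthickening δ S)) (𝓝[>] 0) (𝓝 (μ S)) :=
    (tendsto_measure_cthickening_of_isCompact hSc).mono_left nhdsWithin_le_nhds
  exact le_of_tendsto (ENNReal.Tendsto.sub (tendsto_const_nhds (x := edist (γ s) (γ t))) h2
    (Or.inr (measure_ne_top _ _))) (eventually_nhdsWithin_of_forall hδ)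

/-- Additivity of curve integrals with respect to adjacent intervals. -/
theorem setLIntegral_Ioc_inter_add {f : ℝ → ℝ≥0∞} {B : Set ℝ} (hB : MeasurableSet B) {r s t : ℝ}
    (hrs : r ≤ s) (hst : s ≤ t) :
    (∫⁻ x in Ioc r s ∩ B, f x) + ∫⁻ x in Ioc s t ∩ B, f x = ∫⁻ x in Ioc r t ∩ B, f x := by
  rw [← Ioc_union_Ioc_eq_Ioc hrs hst, union_inter_distrib_right, lintegral_union]
  · exact measurableSet_Ioc.inter hB
  · exact (Ioc_disjoint_Ioc_of_le le_rfl).mono inter_subset_left inter_subset_left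

/-- The length outside a set of finite length is lower semicontinuous. -/
theorem lintegral_compl_le_liminf {A : Set E} (hA : MeasurableSet A)
    (hAfin : Measure.hausdorffMeasure 1 A ≠ ∞) {γs : ℕ → ℝ → E} {γ : ℝ → E} {C K : ℝ≥0}
    (hγs : ∀ j, LipschitzWith C (γs j)) (hγ : LipschitzWith K γ) {s t : ℝ} (hst : s ≤ t)
    (hlim : TendstoUniformlyOn γs γ atTop (Icc s t)) :
    ∫⁻ r in Ioc s t ∩ γ ⁻¹' Aᶜ, ‖deriv γ r‖ₑ ≤
      liminf (fun j ↦ ∫⁻ r in Ioc s t ∩ γs j ⁻¹' Aᶜ, ‖deriv (γs j) r‖ₑ) atTop := by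
  -- Summing the arc estimate over a partition works because liminf is superadditive.
  have hpart : ∀ u : ℕ → ℝ, Monotone u → (∀ i, u i ∈ Icc s t) → ∀ n,
      ∑ i ∈ Finset.range n, edist (γ (u (i + 1))) (γ (u i)) ≤
        liminf (fun j ↦ ∫⁻ r in Ioc (u 0) (u n) ∩ γs j ⁻¹' Aᶜ, ‖deriv (γs j) r‖ₑ) atTop +
          ∫⁻ r in Ioc (u 0) (u n) ∩ γ ⁻¹' A, ‖deriv γ r‖ₑ := by
    intro u hu hus n
    induction n with
    | zero => simp
    | succ n ih =>
      have h0 : u 0 ≤ u n := hu n.zero_le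
      have h1 : u n ≤ u (n + 1) := hu n.le_succ
      have h2 := edist_le_liminf_lintegral_add hA hAfin hγs hγ h1
        (hlim.mono (Icc_subset_Icc (hus n).1 (hus (n + 1)).2))
      rw [Finset.sum_range_succ, edist_comm (γ (u (n + 1)))]
      refine (add_le_add ih h2).trans ?_
      rw [add_add_add_comm, setLIntegral_Ioc_inter_add (hγ.continuous.measurable hA) h0 h1]
      refine add_le_add_left ?_ _
      refine (ENNReal.liminf_add_liminf_le _ _).trans (liminf_le_liminf (Eventually.of_forall fun j ↦ ?_))
      exact (setLIntegral_Ioc_inter_add ((hγs j).continuous.measurable hA.compl) h0 h1).le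
  set B : ℝ≥0∞ := ∫⁻ r in Ioc s t ∩ γ ⁻¹' A, ‖deriv γ r‖ₑ with hB
  -- Needed to cancel the part of `γ` inside `A` at the end.
  have hBfin : B ≠ ∞ := by
    refine ne_top_of_le_ne_top (b := ∫⁻ r in Ioc s t, (K : ℝ≥0∞)) (by simp [ENNReal.mul_eq_top]) ?_
    refine (lintegral_mono_set inter_subset_left).trans (lintegral_mono fun r ↦ ?_)
    rw [enorm_eq_nnnorm, ENNReal.coe_le_coe, ← NNReal.coe_le_coe]
    exact norm_deriv_le_of_lipschitz hγ
  have hvar : eVariationOn γ (Icc s t) ≤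
      liminf (fun j ↦ ∫⁻ r in Ioc s t ∩ γs j ⁻¹' Aᶜ, ‖deriv (γs j) r‖ₑ) atTop + B := by
    refine iSup_le fun p ↦ (hpart p.2.1 p.2.2.1 p.2.2.2 p.1).trans ?_
    have hsub := Ioc_subset_Ioc (p.2.2.2 0).1 (p.2.2.2 p.1).2
    refine add_le_add (liminf_le_liminf (Eventually.of_forall fun j ↦ ?_)) ?_ <;>
      exact lintegral_mono_set (inter_subset_inter_left _ hsub)
  have hlen := (LocallyBoundedVariationOn.lintegral_enorm_deriv_le
    (hγ.lipschitzOnWith (s := univ)).locallyBoundedVariationOn hst).trans hvar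
  rw [setLIntegral_congr Ioc_ae_eq_Icc.symm,
    ← lintegral_inter_add_sdiff _ _ (hγ.continuous.measurable hA), add_comm] at hlen
  exact (ENNReal.add_le_add_iff_right hBfin).1 hlen

/-- The layer cake formula for a weighted length. -/
theorem lintegral_mul_enorm_deriv_eq_lintegral_Ioi {F : E → ℝ≥0∞} (hF : Measurable F) {γ : ℝ → E}
    (hγ : Measurable γ) (s t : ℝ) :
    ∫⁻ x in Ioc s t, F (γ x) * ‖deriv γ x‖ₑ =
      ∫⁻ r in Ioi (0 : ℝ), ∫⁻ x in Ioc s t ∩ γ ⁻¹' {z | F z ≤ ENNReal.ofReal r}ᶜ, ‖deriv γ x‖ₑ := by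
  have hm : MeasurableSet {p : ℝ × ℝ | ENNReal.ofReal p.2 < F (γ p.1)} :=
    measurableSet_lt (by fun_prop) (by fun_prop)
  calc ∫⁻ x in Ioc s t, F (γ x) * ‖deriv γ x‖ₑ
      = ∫⁻ x in Ioc s t, ∫⁻ r in Ioi (0 : ℝ),
          {p : ℝ × ℝ | ENNReal.ofReal p.2 < F (γ p.1)}.indicator (fun p ↦ ‖deriv γ p.1‖ₑ) (x, r) := by
        refine lintegral_congr fun x ↦ ?_
        nth_rewrite 1 [← ENNReal.lintegral_Ioi_indicator_lt (F (γ x))]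
        rw [← lintegral_mul_const _ (measurable_one.indicator
          (measurableSet_lt ENNReal.measurable_ofReal measurable_const))]
        refine lintegral_congr fun r ↦ ?_
        by_cases h : ENNReal.ofReal r < F (γ x) <;> simp [indicator, h]
    _ = ∫⁻ r in Ioi (0 : ℝ), ∫⁻ x in Ioc s t,
          {p : ℝ × ℝ | ENNReal.ofReal p.2 < F (γ p.1)}.indicator (fun p ↦ ‖deriv γ p.1‖ₑ) (x, r) :=
        lintegral_lintegral_swap
          (((measurable_deriv γ).comp measurable_fst).enorm.indicator hm).aemeasurable
    _ = _ := by
        refine lintegral_congr fun r ↦ ?_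
        have hB : MeasurableSet (γ ⁻¹' {z | F z ≤ ENNReal.ofReal r}ᶜ) :=
          hγ (measurableSet_le hF measurable_const).compl
        rw [inter_comm, ← Measure.restrict_restrict hB, ← lintegral_indicator hB]
        refine lintegral_congr fun x ↦ ?_
        by_cases h : ENNReal.ofReal r < F (γ x) <;> simp [indicator, h]

/-- A weighted length is lower semicontinuous under uniform convergence, provided that the weight
has sublevel sets of finite length below its upper bound `a`. -/
theorem lintegral_mul_enorm_deriv_le_liminf {F : E → ℝ≥0∞} (hF : Measurable F) {a : ℝ≥0∞}
    (hFa : ∀ z, F z ≤ a) (hfin : ∀ lam < a, Measure.hausdorffMeasure 1 {z | F z ≤ lam} ≠ ∞)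
    {γs : ℕ → ℝ → E} {γ : ℝ → E} {C K : ℝ≥0} (hγs : ∀ j, LipschitzWith C (γs j))
    (hγ : LipschitzWith K γ) {s t : ℝ} (hlim : TendstoUniformlyOn γs γ atTop (Icc s t)) :
    ∫⁻ x in Ioc s t, F (γ x) * ‖deriv γ x‖ₑ ≤
      liminf (fun j ↦ ∫⁻ x in Ioc s t, F (γs j x) * ‖deriv (γs j) x‖ₑ) atTop := by
  rcases lt_or_ge t s with hst | hst
  · simp [Ioc_eq_empty_of_le hst.le]
  simp only [lintegral_mul_enorm_deriv_eq_lintegral_Ioi hF hγ.continuous.measurable,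
    fun j ↦ lintegral_mul_enorm_deriv_eq_lintegral_Ioi hF (hγs j).continuous.measurable]
  -- Semicontinuity level by level, then Fatou in `r`. Levels `r ≥ a` contribute nothing;
  -- measurability in `r` comes from monotonicity.
  refine le_trans (lintegral_mono fun r ↦ ?_) (lintegral_liminf_le fun j ↦ ?_)
  · rcases lt_or_ge (ENNReal.ofReal r) a with hr | hr
    · exact lintegral_compl_le_liminf (measurableSet_le hF measurable_const) (hfin _ hr) hγs hγ hst
        hlim
    · have : {z | F z ≤ ENNReal.ofReal r} = univ := eq_univ_of_forall fun z ↦ (hFa z).trans hr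
      simp [this]
  · refine Antitone.measurable fun r r' hrr' ↦ lintegral_mono_set ?_
    refine inter_subset_inter_right _ (preimage_mono (compl_subset_compl.2 fun z hz ↦ ?_))
    exact le_trans hz (ENNReal.ofReal_le_ofReal hrr')

/-- If the weight has sublevel sets of finite length, curves of bounded weighted length that
converge to a curve with distinct endpoints eventually meet that curve. -/
theorem eventually_exists_eq_of_lintegral_le {F : E → ℝ≥0∞} (hF : Measurable F)
    (hfin : ∀ lam < ∞, Measure.hausdorffMeasure 1 {z | F z ≤ lam} ≠ ∞)
    {γs : ℕ → ℝ → E} {γ : ℝ → E} {C K : ℝ≥0} (hγs : ∀ j, LipschitzWith C (γs j))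
    (hγ : LipschitzWith K γ) {s t : ℝ} (hst : s ≤ t) (hne : γ s ≠ γ t)
    (hlim : TendstoUniformlyOn γs γ atTop (Icc s t)) {M : ℝ≥0}
    (hM : ∀ j, ∫⁻ x in Ioc s t, F (γs j x) * ‖deriv (γs j) x‖ₑ ≤ M) :
    ∀ᶠ j in atTop, ∃ u ∈ Icc s t, ∃ v ∈ Icc s t, γs j u = γ v := by
  by_contra hcon
  rw [not_eventually] at hcon
  have key : ∀ lam : ℝ≥0, 0 < lam → edist (γ s) (γ t) ≤ M / lam := by
    intro lam hlam
    have hSm : MeasurableSet {z | F z ≤ lam} := measurableSet_le hF measurable_const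
    have hKm : MeasurableSet (γ '' Icc s t) :=
      (isCompact_Icc.image hγ.continuous).measurableSet
    -- With the image of `γ` removed from the sublevel set, the term for `γ` vanishes. A curve `γs
    -- j` missing that image has friction above `lam` wherever it is outside the removed set's
    -- remainder, so Chebyshev bounds its length there by `M / lam`.
    have h1 := edist_le_liminf_lintegral_add (hSm.diff hKm)
      (measure_ne_top_of_subset sdiff_subset (hfin lam ENNReal.coe_lt_top)) hγs hγ hst hlim
    have h2 : Ioc s t ∩ γ ⁻¹' ({z | F z ≤ lam} \ γ '' Icc s t) = ∅ :=
      eq_empty_of_forall_notMem fun x hx ↦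
        hx.2.2 (mem_image_of_mem _ (Ioc_subset_Icc_self hx.1))
    rw [h2, Measure.restrict_empty, lintegral_zero_measure, add_zero] at h1
    refine h1.trans (liminf_le_of_frequently_le' (hcon.mono fun j hj ↦ ?_))
    have hlam' : (lam : ℝ≥0∞) ≠ 0 := by simpa using hlam.ne'
    rw [ENNReal.le_div_iff_mul_le (Or.inl hlam') (Or.inl ENNReal.coe_ne_top), mul_comm,
      ← lintegral_const_mul _ (measurable_deriv (γs j)).enorm]
    have hcm := (hγs j).continuous.measurable
    refine (setLIntegral_mono ((hF.comp hcm).mul (measurable_deriv (γs j)).enorm)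
      fun x hx ↦ ?_).trans ((lintegral_mono_set inter_subset_left).trans (hM j))
    have hlt : (lam : ℝ≥0∞) < F (γs j x) := by
      by_contra hle
      refine hx.2 ⟨not_lt.1 hle, fun ⟨v, hv, hvx⟩ ↦ hj ?_⟩
      exact ⟨x, Ioc_subset_Icc_self hx.1, v, hv, hvx.symm⟩
    exact mul_le_mul_left hlt.le _
  have hlim0 : Tendsto (fun k : ℕ ↦ (M : ℝ≥0∞) / ((k + 1 : ℕ) : ℝ≥0∞)) atTop (𝓝 0) :=
    (tendsto_add_atTop_iff_nat (f := fun k : ℕ ↦ (M : ℝ≥0∞) / (k : ℝ≥0∞)) 1).2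
      (ENNReal.Tendsto.const_div ENNReal.tendsto_nat_nhds_top (Or.inr ENNReal.coe_ne_top) |>.trans
        (by simp))
  have h0 : edist (γ s) (γ t) ≤ 0 := ge_of_tendsto' hlim0 fun k ↦ by
    simpa using key (k + 1) (by positivity)
  exact hne (edist_le_zero.1 h0)

end Semicontinuity

/-! ### Costs of arcs and cheap end arcs -/

/-- The cost of travelling along `γ` from time `s` to time `t` with friction coefficient `F`. -/
def arcCost {E : Type*} [NormedAddCommGroup E] [NormedSpace ℝ E] (F : E → ℝ≥0∞) (γ : ℝ → E)
    (s t : ℝ) : ℝ≥0∞ :=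
  ∫⁻ x in Ioc s t, F (γ x) * ‖deriv γ x‖ₑ

section ArcCost

variable {E : Type*} [NormedAddCommGroup E] [NormedSpace ℝ E] {F : E → ℝ≥0∞} {γ : ℝ → E}

theorem arcCost_add {r s t : ℝ} (hrs : r ≤ s) (hst : s ≤ t) :
    arcCost F γ r s + arcCost F γ s t = arcCost F γ r t := by
  simpa [arcCost] using setLIntegral_Ioc_inter_add (f := fun x ↦ F (γ x) * ‖deriv γ x‖ₑ)
    MeasurableSet.univ hrs hst

theorem arcCost_mono {s t s' t' : ℝ} (hs : s' ≤ s) (ht : t ≤ t') :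
    arcCost F γ s t ≤ arcCost F γ s' t' :=
  lintegral_mono_set (Ioc_subset_Ioc hs ht)

theorem arcCost_eq_zero_of_constant {s t : ℝ} {p : E} (h : ∀ x ∈ Ioo s t, γ x = p) :
    arcCost F γ s t = 0 := by
  rw [arcCost, setLIntegral_congr Ioo_ae_eq_Ioc.symm]
  refine setLIntegral_eq_zero measurableSet_Ioo fun x hx ↦ ?_
  have h1 : γ =ᶠ[𝓝 x] fun _ ↦ p := by
    filter_upwards [Ioo_mem_nhds hx.1 hx.2] with y hy using h y hy
  simp [h1.deriv_eq]

/-- The cost of a short arc is small. -/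
theorem exists_pos_arcCost_le (hfin : arcCost F γ 0 1 ≠ ∞) {ε : ℝ≥0∞} (hε : ε ≠ 0) :
    ∃ δ > 0, ∀ s t, 0 ≤ s → t ≤ 1 → t - s < δ → arcCost F γ s t ≤ ε := by
  obtain ⟨δ, hδ, h⟩ := exists_pos_setLIntegral_lt_of_measure_lt
    (μ := volume.restrict (Ioc (0 : ℝ) 1)) hfin hε
  obtain ⟨η, hη, hηδ⟩ := ENNReal.lt_iff_exists_nnreal_btwn.1 hδ
  refine ⟨η, by simpa using hη, fun s t hs ht hst ↦ ?_⟩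
  have hsub : Ioc s t ⊆ Ioc 0 1 := Ioc_subset_Ioc hs ht
  have h1 := h (Ioc s t) (by
    rw [Measure.restrict_apply measurableSet_Ioc, inter_eq_left.2 hsub, Real.volume_Ioc]
    refine lt_of_le_of_lt ?_ hηδ
    rw [← ENNReal.ofReal_coe_nnreal]
    exact ENNReal.ofReal_le_ofReal hst.le)
  rw [Measure.restrict_restrict measurableSet_Ioc, inter_eq_left.2 hsub] at h1
  exact h1.le

/-- A nonconstant curve of finite cost leaves its starting point at small cost. -/
theorem exists_ne_source_arcCost_le (hfin : arcCost F γ 0 1 ≠ ∞)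
    (hne : ∃ t ∈ Icc (0 : ℝ) 1, γ t ≠ γ 0) {ε : ℝ≥0∞} (hε : ε ≠ 0) :
    ∃ t ∈ Icc (0 : ℝ) 1, γ 0 ≠ γ t ∧ arcCost F γ 0 t ≤ ε := by
  -- Before `sInf T` the curve rests at no cost. The infimum itself may lie outside `T`, so a
  -- slightly later time is taken.
  set T : Set ℝ := {t | t ∈ Icc (0 : ℝ) 1 ∧ γ t ≠ γ 0} with hT
  have hTbdd : BddBelow T := ⟨0, fun t ht ↦ ht.1.1⟩
  have h0 : 0 ≤ sInf T := le_csInf hne fun t ht ↦ ht.1.1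
  obtain ⟨δ, hδ, h⟩ := exists_pos_arcCost_le hfin hε
  obtain ⟨t, ht, htδ⟩ := Real.lt_sInf_add_pos (s := T) hne hδ
  have hle : sInf T ≤ t := csInf_le hTbdd ht
  refine ⟨t, ht.1, ht.2.symm, ?_⟩
  rw [← arcCost_add h0 hle, arcCost_eq_zero_of_constant (p := γ 0), zero_add]
  · exact h _ _ h0 ht.1.2 (by linarith)
  · intro x hx
    by_contra hxne
    exact hx.2.not_ge (csInf_le hTbdd ⟨⟨hx.1.le, (hx.2.le.trans hle).trans ht.1.2⟩, hxne⟩)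

/-- A nonconstant curve of finite cost reaches its endpoint from elsewhere at small cost. -/
theorem exists_ne_target_arcCost_le (hfin : arcCost F γ 0 1 ≠ ∞)
    (hne : ∃ t ∈ Icc (0 : ℝ) 1, γ t ≠ γ 1) {ε : ℝ≥0∞} (hε : ε ≠ 0) :
    ∃ t ∈ Icc (0 : ℝ) 1, γ t ≠ γ 1 ∧ arcCost F γ t 1 ≤ ε := by
  set T : Set ℝ := {t | t ∈ Icc (0 : ℝ) 1 ∧ γ t ≠ γ 1} with hT
  have hTbdd : BddAbove T := ⟨1, fun t ht ↦ ht.1.2⟩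
  have h0 : sSup T ≤ 1 := csSup_le hne fun t ht ↦ ht.1.2
  obtain ⟨δ, hδ, h⟩ := exists_pos_arcCost_le hfin hε
  obtain ⟨t, ht, htδ⟩ := exists_lt_of_lt_csSup (s := T) hne (sub_lt_self _ hδ)
  have hle : t ≤ sSup T := le_csSup hTbdd ht
  refine ⟨t, ht.1, ht.2, ?_⟩
  rw [← arcCost_add hle h0, arcCost_eq_zero_of_constant (s := sSup T) (p := γ 1), add_zero]
  · exact h _ _ ht.1.1 h0 (by linarith)
  · intro x hx
    by_contra hxne
    exact hx.1.not_ge (le_csSup hTbdd ⟨⟨(ht.1.1.trans hle).trans hx.1.le, hx.2.le⟩, hxne⟩)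

end ArcCost

/-! ### The friction coefficient as a Borel function -/

namespace UrbanMetric

section Friction

variable {n : ℕ} {S : Set (EuclideanSpace ℝ (Fin n))} {a : ℝ≥0∞}
  {b : EuclideanSpace ℝ (Fin n) → ℝ≥0∞}

theorem IsNetwork.friction_le (hS : IsNetwork S a b) (z : EuclideanSpace ℝ (Fin n)) :
    friction S a b z ≤ a := by
  unfold friction
  split_ifs with h
  · exact hS.le_cost z h
  · exact le_rfl

theorem setOf_friction_le_eq_sublevel {lam : ℝ≥0∞} (hlam : lam < a) :
    {z | friction S a b z ≤ lam} = sublevel S b lam := by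
  ext z
  by_cases h : z ∈ S <;> simp [friction, sublevel, h, hlam]

/-- Sublevel sets below `a` are relatively closed in the Borel set `S`; all others are the whole
space. -/
theorem IsNetwork.measurable_friction (hS : IsNetwork S a b) : Measurable (friction S a b) := by
  refine measurable_of_Iic fun lam ↦ ?_
  rcases lt_or_ge lam a with h | h
  · have h1 : friction S a b ⁻¹' Iic lam = sublevel S b lam := setOf_friction_le_eq_sublevel h
    obtain ⟨v, hv, hSv⟩ := lowerSemicontinuousOn_iff_preimage_Iic.1 hS.lowerSemicontinuousOn lam
    have h2 : sublevel S b lam = S ∩ v := hSv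
    rw [h1, h2]
    exact hS.measurableSet.inter hv.measurableSet
  · have h1 : friction S a b ⁻¹' Iic lam = univ :=
      eq_univ_of_forall fun z ↦ (hS.friction_le z).trans h
    rw [h1]
    exact MeasurableSet.univ

theorem IsNetwork.hausdorffMeasure_friction_le_ne_top (hS : IsNetwork S a b) {lam : ℝ≥0∞}
    (hlam : lam < a) : Measure.hausdorffMeasure 1 {z | friction S a b z ≤ lam} ≠ ∞ := by
  rw [setOf_friction_le_eq_sublevel hlam]
  exact (hS.finite_sublevel lam hlam).ne

theorem IsNetwork.imageCost_eq (hS : IsNetwork S a b) {γ : ℝ → EuclideanSpace ℝ (Fin n)}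
    (hγ : ContinuousOn γ (Icc 0 1)) :
    imageCost S a b γ =
      ∫⁻ z in γ '' Icc 0 1, friction S a b z ∂(Measure.hausdorffMeasure 1) := by
  have hm : MeasurableSet (γ '' Icc 0 1) := (isCompact_Icc.image_of_continuousOn hγ).measurableSet
  rw [imageCost,
    ← lintegral_inter_add_sdiff (friction S a b) (γ '' Icc 0 1) hS.measurableSet]
  congr 1
  · refine setLIntegral_congr_fun (hm.inter hS.measurableSet) fun z hz ↦ ?_
    simp [friction, hz.2]
  · rw [← setLIntegral_const]
    refine setLIntegral_congr_fun (hm.diff hS.measurableSet) fun z hz ↦ ?_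
    simp [friction, hz.2]

end Friction

/-! ### Paths and the urban metric -/

/-- The extension of a path on `[0,1]` to the real line by its endpoints. -/
def extendPath {n : ℕ} (γ : ℝ → EuclideanSpace ℝ (Fin n)) (t : ℝ) : EuclideanSpace ℝ (Fin n) :=
  γ (projIcc (0 : ℝ) 1 zero_le_one t)

section Paths

variable {n : ℕ} {S : Set (EuclideanSpace ℝ (Fin n))} {a : ℝ≥0∞}
  {b : EuclideanSpace ℝ (Fin n) → ℝ≥0∞} {x y z : EuclideanSpace ℝ (Fin n)}
  {γ : ℝ → EuclideanSpace ℝ (Fin n)} {K : ℝ≥0}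

theorem convex_cube (n : ℕ) : Convex ℝ (cube n) := by
  intro x hx y hy s t hs ht hst i
  simpa using convex_Icc (-1 : ℝ) 1 (hx i) (hy i) hs ht hst

theorem lipschitzWith_extendPath (hγ : LipschitzOnWith K γ (Icc 0 1)) :
    LipschitzWith K (extendPath γ) := by
  simpa using! hγ.to_restrict.comp (LipschitzWith.projIcc (zero_le_one (α := ℝ)))

theorem extendPath_of_mem {t : ℝ} (ht : t ∈ Icc (0 : ℝ) 1) : extendPath γ t = γ t := by
  rw [extendPath, projIcc_of_mem zero_le_one ht]

theorem extendPath_of_le_zero {t : ℝ} (ht : t ≤ 0) : extendPath γ t = γ 0 := by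
  rw [extendPath, projIcc_of_le_left _ ht]

theorem extendPath_of_one_le {t : ℝ} (ht : 1 ≤ t) : extendPath γ t = γ 1 := by
  rw [extendPath, projIcc_of_right_le _ ht]

theorem extendPath_mem_image (γ : ℝ → EuclideanSpace ℝ (Fin n)) (t : ℝ) :
    extendPath γ t ∈ γ '' Icc 0 1 :=
  mem_image_of_mem _ (projIcc (0 : ℝ) 1 zero_le_one t).2

/-- Only at the two endpoints can the derivative within [0,1] differ from that of the extension, a
null set. This permits working with globally Lipschitz curves. -/
theorem length_eq_arcCost :
    length S a b γ = arcCost (friction S a b) (extendPath γ) 0 1 := by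
  rw [length, arcCost, ← setLIntegral_congr (Ioo_ae_eq_Icc (a := (0 : ℝ)) (b := 1)),
    ← setLIntegral_congr (Ioo_ae_eq_Ioc (a := (0 : ℝ)) (b := 1))]
  refine setLIntegral_congr_fun measurableSet_Ioo fun t ht ↦ ?_
  have h1 : extendPath γ =ᶠ[𝓝 t] γ := by
    filter_upwards [Ioo_mem_nhds ht.1 ht.2] with r hr
    exact extendPath_of_mem (Ioo_subset_Icc_self hr)
  simp only [h1.deriv_eq, extendPath_of_mem (γ := γ) (Ioo_subset_Icc_self ht),
    derivWithin_of_mem_nhds (Icc_mem_nhds ht.1 ht.2)]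

theorem IsPath.urbanDist_le (hγ : IsPath K x y γ) (hS : IsNetwork S a b) :
    urbanDist S a b x y ≤
      ∫⁻ z in γ '' Icc 0 1, friction S a b z ∂(Measure.hausdorffMeasure 1) := by
  rw [← hS.imageCost_eq hγ.lipschitz.continuousOn]
  exact iInf₂_le γ ⟨K, hγ⟩

/-- The urban metric satisfies the triangle inequality. -/
theorem urbanDist_triangle (hS : IsNetwork S a b) (x y z : EuclideanSpace ℝ (Fin n)) :
    urbanDist S a b x z ≤ urbanDist S a b x y + urbanDist S a b y z := by
  conv_rhs => unfold urbanDist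
  simp only [ENNReal.iInf_add, ENNReal.add_iInf]
  refine le_iInf fun τ ↦ le_iInf fun ⟨K', hτ⟩ ↦ le_iInf fun σ ↦ le_iInf fun ⟨K, hσ⟩ ↦ ?_
  set σ' := extendPath σ with hσ'
  set τ' := extendPath τ with hτ'
  -- Concatenation without gluing: on each half one summand is frozen at `y`, so `ρ` is Lipschitz as
  -- a sum.
  set ρ : ℝ → EuclideanSpace ℝ (Fin n) := fun t ↦ σ' (2 * t) + τ' (2 * t - 1) - y with hρ
  have hσ1 : ∀ t, 1 ≤ t → σ' t = y := fun t ht ↦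
    (extendPath_of_one_le ht).trans hσ.target
  have hτ0 : ∀ t, t ≤ 0 → τ' t = y := fun t ht ↦
    (extendPath_of_le_zero ht).trans hτ.source
  have hρ1 : ∀ t, t ≤ 1 / 2 → ρ t = σ' (2 * t) := fun t ht ↦ by
    simp [hρ, hτ0 (2 * t - 1) (by linarith)]
  have hρ2 : ∀ t, 1 / 2 ≤ t → ρ t = τ' (2 * t - 1) := fun t ht ↦ by
    simp [hρ, hσ1 (2 * t) (by linarith)]
  have himage : ρ '' Icc 0 1 ⊆ σ '' Icc 0 1 ∪ τ '' Icc 0 1 := by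
    rintro _ ⟨t, ht, rfl⟩
    rcases le_total t (1 / 2) with h | h
    · rw [hρ1 t h]
      exact Or.inl (extendPath_mem_image _ _)
    · rw [hρ2 t h]
      exact Or.inr (extendPath_mem_image _ _)
  have hl : ∃ L, LipschitzWith L ρ := by
    have h2 : LipschitzWith 2 fun t : ℝ ↦ 2 * t := LipschitzWith.of_dist_le_mul fun r t ↦ by
      rw [Real.dist_eq, Real.dist_eq, ← mul_sub, abs_mul]
      norm_num
    have h3 : LipschitzWith 2 fun t : ℝ ↦ 2 * t - 1 := LipschitzWith.of_dist_le_mul fun r t ↦ by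
      rw [dist_sub_right]
      exact h2.dist_le_mul r t
    exact ⟨_, (((lipschitzWith_extendPath hσ.lipschitz).comp h2).add
      ((lipschitzWith_extendPath hτ.lipschitz).comp h3)).sub (LipschitzWith.const y)⟩
  obtain ⟨L, hL⟩ := hl
  have hpath : IsPath L x z ρ :=
    { lipschitz := hL.lipschitzOnWith
      mapsTo := fun t ht ↦ by
        rcases himage (mem_image_of_mem ρ ht) with ⟨r, hr, h⟩ | ⟨r, hr, h⟩
        · exact h ▸ hσ.mapsTo hr
        · exact h ▸ hτ.mapsTo hr
      source := by
        rw [hρ1 0 (by norm_num), hσ', extendPath_of_le_zero (by norm_num), hσ.source]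
      target := by
        rw [hρ2 1 (by norm_num), hτ', extendPath_of_one_le (by norm_num), hτ.target] }
  rw [hS.imageCost_eq hσ.lipschitz.continuousOn, hS.imageCost_eq hτ.lipschitz.continuousOn]
  exact (hpath.urbanDist_le hS).trans
    ((lintegral_mono_set himage).trans (lintegral_union_le _ _ _))

/-- The urban distance of two points on an arc is at most the cost of the arc. -/
theorem urbanDist_le_arcCost (hS : IsNetwork S a b) (hγ : LipschitzWith K γ)
    (hmaps : MapsTo γ (Icc 0 1) (cube n)) {s t u v : ℝ} (hs : 0 ≤ s) (ht : t ≤ 1)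
    (hu : u ∈ Icc s t) (hv : v ∈ Icc s t) :
    urbanDist S a b (γ u) (γ v) ≤ arcCost (friction S a b) γ s t := by
  -- The reparametrization may run backwards; `u ≤ v` is not assumed.
  have hsub : AffineMap.lineMap u v '' Icc (0 : ℝ) 1 ⊆ Icc s t := by
    rw [← segment_eq_image_lineMap]
    exact (convex_Icc s t).segment_subset hu hv
  have hmem : ∀ r ∈ Icc (0 : ℝ) 1, AffineMap.lineMap u v r ∈ Icc s t := fun r hr ↦
    hsub (mem_image_of_mem _ hr)
  have hpath : IsPath (K * nndist u v) (γ u) (γ v) (γ ∘ AffineMap.lineMap u v) :=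
    { lipschitz := (hγ.comp (lipschitzWith_lineMap u v)).lipschitzOnWith
      mapsTo := fun r hr ↦ hmaps (Icc_subset_Icc hs ht (hmem r hr))
      source := by simp
      target := by simp }
  refine (hpath.urbanDist_le hS).trans ?_
  rw [image_comp, arcCost, setLIntegral_congr Ioc_ae_eq_Icc]
  exact (lintegral_mono_set (image_mono hsub)).trans
    (hγ.setLIntegral_image_le measurableSet_Icc isCompact_Icc.measure_lt_top.ne
      hS.measurable_friction)

/-- The urban metric is at most `a` times the Euclidean metric. -/
theorem urbanDist_le_mul_edist (hS : IsNetwork S a b) (hx : x ∈ cube n) (hy : y ∈ cube n) :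
    urbanDist S a b x y ≤ a * edist x y := by
  have hseg : AffineMap.lineMap x y '' Icc (0 : ℝ) 1 = segment ℝ x y :=
    (segment_eq_image_lineMap ℝ x y).symm
  have hpath : IsPath (nndist x y) x y (AffineMap.lineMap x y) :=
    { lipschitz := (lipschitzWith_lineMap x y).lipschitzOnWith
      mapsTo := fun r hr ↦ (convex_cube n).segment_subset hx hy
        (hseg ▸ mem_image_of_mem _ hr)
      source := by simp
      target := by simp }
  refine (hpath.urbanDist_le hS).trans ?_
  rw [hseg, ← hausdorffMeasure_segment, ← setLIntegral_const]
  exact lintegral_mono hS.friction_le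

end Paths

/-! ### Optimality of the limit curve -/

section Limit

variable {n : ℕ} {S : Set (EuclideanSpace ℝ (Fin n))} {a : ℝ≥0∞}
  {b : EuclideanSpace ℝ (Fin n) → ℝ≥0∞} {γs : ℕ → ℝ → EuclideanSpace ℝ (Fin n)}
  {γ : ℝ → EuclideanSpace ℝ (Fin n)} {C : ℝ≥0}

/-- Near a point `γ p` of the limit curve, the converging curves have points at small urban
distance from `γ p`. -/
theorem eventually_exists_urbanDist_le (hS : IsNetwork S a b) (hγs : ∀ j, LipschitzWith C (γs j))
    (hγ : LipschitzWith C γ) (hmaps : ∀ j, MapsTo (γs j) (Icc 0 1) (cube n))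
    (hmap : MapsTo γ (Icc 0 1) (cube n)) (hlim : TendstoUniformlyOn γs γ atTop (Icc 0 1)) {M : ℝ≥0}
    (hM : ∀ j, arcCost (friction S a b) (γs j) 0 1 ≤ M) {s t p : ℝ} (hs : 0 ≤ s) (ht : t ≤ 1)
    (hp : p ∈ Icc s t) (hne : γ s ≠ γ t) {ε : ℝ≥0∞} (hε : ε ≠ 0)
    (hcost : arcCost (friction S a b) γ s t ≤ ε) :
    ∀ᶠ j in atTop, ∃ u ∈ Icc s t,
      urbanDist S a b (γs j u) (γ p) ≤ ε ∧ urbanDist S a b (γ p) (γs j u) ≤ ε := by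
  have hpI : p ∈ Icc (0 : ℝ) 1 := Icc_subset_Icc hs ht hp
  -- For `a = ∞` take a point where `γs j` meets the cheap arc of `γ` and follow that arc to `γ p`;
  -- for finite `a` the time `p` itself works.
  by_cases ha : a = ∞
  · subst ha
    filter_upwards [eventually_exists_eq_of_lintegral_le hS.measurable_friction
      (fun lam hlam ↦ hS.hausdorffMeasure_friction_le_ne_top hlam) hγs hγ (hp.1.trans hp.2) hne
      (hlim.mono (Icc_subset_Icc hs ht)) (fun j ↦ (arcCost_mono hs ht).trans (hM j))]
      with j ⟨u, hu, v, hv, huv⟩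
    refine ⟨u, hu, ?_, ?_⟩ <;> rw [huv]
    · exact (urbanDist_le_arcCost hS hγ hmap hs ht hv hp).trans hcost
    · exact (urbanDist_le_arcCost hS hγ hmap hs ht hp hv).trans hcost
  · have h1 : Tendsto (fun j ↦ a * edist (γs j p) (γ p)) atTop (𝓝 0) := by
      have h2 := (hlim.tendsto_at hpI).edist (tendsto_const_nhds (x := γ p))
      rw [edist_self] at h2
      simpa using ENNReal.Tendsto.const_mul h2 (Or.inr ha)
    filter_upwards [h1.eventually_le_const (pos_iff_ne_zero.2 hε)] with j hj
    refine ⟨p, hp, (urbanDist_le_mul_edist hS (hmaps j hpI) (hmap hpI)).trans hj, ?_⟩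
    exact (urbanDist_le_mul_edist hS (hmap hpI) (hmaps j hpI)).trans (by rwa [edist_comm])

/-- An arc of an optimal curve is optimal. -/
theorem arcCost_le_urbanDist_of_le (hS : IsNetwork S a b) (hγ : LipschitzWith C γ)
    (hmap : MapsTo γ (Icc 0 1) (cube n)) (hfin : arcCost (friction S a b) γ 0 1 ≠ ∞)
    (hopt : arcCost (friction S a b) γ 0 1 ≤ urbanDist S a b (γ 0) (γ 1)) {s t : ℝ} (hs : 0 ≤ s)
    (hst : s ≤ t) (ht : t ≤ 1) :
    arcCost (friction S a b) γ s t ≤ urbanDist S a b (γ s) (γ t) := by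
  have hs1 := hst.trans ht
  have ht0 := hs.trans hst
  have h1 : urbanDist S a b (γ 0) (γ s) ≤ arcCost (friction S a b) γ 0 s :=
    urbanDist_le_arcCost hS hγ hmap le_rfl hs1 ⟨le_rfl, hs⟩ ⟨hs, le_rfl⟩
  have h2 : urbanDist S a b (γ t) (γ 1) ≤ arcCost (friction S a b) γ t 1 :=
    urbanDist_le_arcCost hS hγ hmap ht0 le_rfl ⟨le_rfl, ht⟩ ⟨ht, le_rfl⟩
  -- A detour cheaper than the middle arc would beat the whole curve; the outer arcs are finite and
  -- cancel.
  have h3 : urbanDist S a b (γ 0) (γ 1) ≤ arcCost (friction S a b) γ 0 s +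
      (urbanDist S a b (γ s) (γ t) + arcCost (friction S a b) γ t 1) :=
    (urbanDist_triangle hS _ (γ s) _).trans
      (add_le_add h1 ((urbanDist_triangle hS _ (γ t) _).trans (add_le_add_right h2 _)))
  have h4 := hopt.trans h3
  rw [← arcCost_add hs hs1, ← arcCost_add hst ht] at h4
  have hf1 : arcCost (friction S a b) γ 0 s ≠ ∞ :=
    ne_top_of_le_ne_top hfin (arcCost_mono le_rfl hs1)
  have hf2 : arcCost (friction S a b) γ t 1 ≠ ∞ :=
    ne_top_of_le_ne_top hfin (arcCost_mono ht0 le_rfl)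
  exact (ENNReal.add_le_add_iff_right hf2).1 ((ENNReal.add_le_add_iff_left hf1).1 h4)

/-- The uniform limit of optimal curves of bounded cost is optimal. -/
theorem arcCost_le_urbanDist_of_tendsto (hS : IsNetwork S a b)
    (hγs : ∀ j, LipschitzWith C (γs j)) (hγ : LipschitzWith C γ)
    (hmaps : ∀ j, MapsTo (γs j) (Icc 0 1) (cube n)) (hmap : MapsTo γ (Icc 0 1) (cube n))
    (hlim : TendstoUniformlyOn γs γ atTop (Icc 0 1)) {M : ℝ≥0}
    (hM : ∀ j, arcCost (friction S a b) (γs j) 0 1 ≤ M)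
    (hopt : ∀ j, arcCost (friction S a b) (γs j) 0 1 ≤ urbanDist S a b (γs j 0) (γs j 1)) :
    arcCost (friction S a b) γ 0 1 ≤ urbanDist S a b (γ 0) (γ 1) := by
  have hlsc : ∀ s t, 0 ≤ s → t ≤ 1 → arcCost (friction S a b) γ s t ≤
      liminf (fun j ↦ arcCost (friction S a b) (γs j) s t) atTop := fun s t hs ht ↦
    lintegral_mul_enorm_deriv_le_liminf hS.measurable_friction hS.friction_le
      (fun lam hlam ↦ hS.hausdorffMeasure_friction_le_ne_top hlam) hγs hγ
      (hlim.mono (Icc_subset_Icc hs ht))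
  have hfin : arcCost (friction S a b) γ 0 1 ≠ ∞ :=
    ne_top_of_le_ne_top ENNReal.coe_ne_top ((hlsc 0 1 le_rfl le_rfl).trans
      (liminf_le_of_frequently_le' (Frequently.of_forall hM)))
  -- A constant limit has no time away from its endpoints, so trimming is impossible, but its cost
  -- is zero.
  by_cases hconst : ∀ t ∈ Icc (0 : ℝ) 1, γ t = γ 0
  · rw [arcCost_eq_zero_of_constant fun t ht ↦ hconst t (Ioo_subset_Icc_self ht)]
    exact zero_le
  push Not at hconst
  have hconst' : ∃ t ∈ Icc (0 : ℝ) 1, γ t ≠ γ 1 := by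
    by_contra! hc
    obtain ⟨t, ht, h⟩ := hconst
    exact h ((hc t ht).trans (hc 0 ⟨le_rfl, zero_le_one⟩).symm)
  refine ENNReal.le_of_forall_pos_le_add fun ε hε _ ↦ ?_
  -- Four errors: two trimmed end arcs, and two connections from `γs j` to the endpoints of `γ`.
  set η : ℝ≥0∞ := (ε : ℝ≥0∞) / 4 with hη
  have hη0 : η ≠ 0 := by simp [hη, hε.ne']
  obtain ⟨s, hs, hsne, hscost⟩ := exists_ne_source_arcCost_le hfin hconst hη0
  obtain ⟨t, ht, htne, htcost⟩ := exists_ne_target_arcCost_le hfin hconst' hη0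
  have hmid : arcCost (friction S a b) γ s t ≤ η + (urbanDist S a b (γ 0) (γ 1) + η) := by
    rcases lt_or_ge t s with hts | hst
    · simp [arcCost, Ioc_eq_empty_of_le hts.le]
    refine (hlsc s t hs.1 ht.2).trans (liminf_le_of_frequently_le' (Eventually.frequently ?_))
    filter_upwards [eventually_exists_urbanDist_le hS hγs hγ hmaps hmap hlim hM le_rfl hs.2
        ⟨le_rfl, hs.1⟩ hsne hη0 hscost,
      eventually_exists_urbanDist_le hS hγs hγ hmaps hmap hlim hM ht.1 le_rfl
        ⟨ht.2, le_rfl⟩ htne hη0 htcost] with j ⟨u, hu, hu1, _⟩ ⟨v, hv, _, hv2⟩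
    -- Here u ≤ s ≤ t ≤ v, so the optimal arc of `γs j` from `u` to `v` contains the one over [s,t].
    calc arcCost (friction S a b) (γs j) s t ≤ arcCost (friction S a b) (γs j) u v :=
          arcCost_mono hu.2 hv.1
      _ ≤ urbanDist S a b (γs j u) (γs j v) :=
          arcCost_le_urbanDist_of_le hS (hγs j) (hmaps j)
            (ne_top_of_le_ne_top ENNReal.coe_ne_top (hM j)) (hopt j) hu.1
            (hu.2.trans (hst.trans hv.1)) hv.2
      _ ≤ η + (urbanDist S a b (γ 0) (γ 1) + η) :=
          (urbanDist_triangle hS _ (γ 0) _).trans (add_le_add hu1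
            ((urbanDist_triangle hS _ (γ 1) _).trans (add_le_add_right hv2 _)))
  calc arcCost (friction S a b) γ 0 1
      ≤ arcCost (friction S a b) γ 0 s +
          (arcCost (friction S a b) γ s t + arcCost (friction S a b) γ t 1) := by
        rcases le_total s t with hst | hts
        · rw [arcCost_add hst ht.2, arcCost_add hs.1 hs.2]
        · rw [← arcCost_add hs.1 hs.2]
          exact add_le_add_right ((arcCost_mono hts le_rfl).trans le_add_self) _
    _ ≤ η + ((η + (urbanDist S a b (γ 0) (γ 1) + η)) + η) := by gcongr
    _ = urbanDist S a b (γ 0) (γ 1) + 4 * η := by ring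
    _ = urbanDist S a b (γ 0) (γ 1) + ε := by
        rw [hη, ENNReal.mul_div_cancel (by simp) (by simp)]

end Limit

end UrbanMetric

theorem mainTheorem7 (n : ℕ) (S : Set (EuclideanSpace ℝ (Fin n))) (a : ℝ≥0∞)
    (b : EuclideanSpace ℝ (Fin n) → ℝ≥0∞) (hS : UrbanMetric.IsNetwork S a b)
    (xs ys : ℕ → EuclideanSpace ℝ (Fin n)) (x y : EuclideanSpace ℝ (Fin n))
    (hbdd : ∃ M : ℝ≥0, ∀ j, UrbanMetric.urbanDist S a b (xs j) (ys j) ≤ M)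
    (C : ℝ≥0) (γs : ℕ → ℝ → EuclideanSpace ℝ (Fin n)) (γ : ℝ → EuclideanSpace ℝ (Fin n))
    (hγs : ∀ j, UrbanMetric.IsPath C (xs j) (ys j) (γs j))
    (hopt : ∀ j, UrbanMetric.length S a b (γs j) = UrbanMetric.urbanDist S a b (xs j) (ys j))
    (hspeed : ∀ j, UrbanMetric.ConstantSpeed (γs j))
    (hγ : UrbanMetric.IsPath C x y γ)
    (hlim : TendstoUniformlyOn γs γ atTop (Icc 0 1)) :
    UrbanMetric.length S a b γ = UrbanMetric.urbanDist S a b x y := by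
  obtain ⟨M, hM⟩ := hbdd
  have hmap : ∀ {f : ℝ → EuclideanSpace ℝ (Fin n)} {p q : EuclideanSpace ℝ (Fin n)},
      UrbanMetric.IsPath C p q f →
        MapsTo (UrbanMetric.extendPath f) (Icc 0 1) (UrbanMetric.cube n) :=
    fun hf t _ ↦ hf.mapsTo.image_subset (UrbanMetric.extendPath_mem_image _ t)
  have hlim' : TendstoUniformlyOn (fun j ↦ UrbanMetric.extendPath (γs j))
      (UrbanMetric.extendPath γ) atTop (Icc 0 1) := by
    refine (hlim.congr (Eventually.of_forall fun j t ht ↦ ?_)).congr_right fun t ht ↦ ?_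
    · exact (UrbanMetric.extendPath_of_mem ht).symm
    · exact (UrbanMetric.extendPath_of_mem ht).symm
  have hsource : ∀ {f : ℝ → EuclideanSpace ℝ (Fin n)} {p q : EuclideanSpace ℝ (Fin n)},
      UrbanMetric.IsPath C p q f → UrbanMetric.extendPath f 0 = p :=
    fun hf ↦ (UrbanMetric.extendPath_of_le_zero le_rfl).trans hf.source
  have htarget : ∀ {f : ℝ → EuclideanSpace ℝ (Fin n)} {p q : EuclideanSpace ℝ (Fin n)},
      UrbanMetric.IsPath C p q f → UrbanMetric.extendPath f 1 = q :=
    fun hf ↦ (UrbanMetric.extendPath_of_one_le le_rfl).trans hf.target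
  refine le_antisymm ?_ ?_
  · have := UrbanMetric.arcCost_le_urbanDist_of_tendsto hS
      (fun j ↦ UrbanMetric.lipschitzWith_extendPath (hγs j).lipschitz)
      (UrbanMetric.lipschitzWith_extendPath hγ.lipschitz) (fun j ↦ hmap (hγs j)) (hmap hγ) hlim'
      (M := M) (fun j ↦ by
        rw [← UrbanMetric.length_eq_arcCost, hopt j]
        exact hM j)
      (fun j ↦ by
        rw [← UrbanMetric.length_eq_arcCost, hopt j, hsource (hγs j), htarget (hγs j)])
    rwa [← UrbanMetric.length_eq_arcCost, hsource hγ, htarget hγ] at this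
  · have := UrbanMetric.urbanDist_le_arcCost hS
      (UrbanMetric.lipschitzWith_extendPath hγ.lipschitz) (hmap hγ) le_rfl le_rfl
      (left_mem_Icc.2 zero_le_one) (right_mem_Icc.2 zero_le_one)
    rwa [← UrbanMetric.length_eq_arcCost, hsource hγ, htarget hγ] at this

end
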